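/- For real $\alpha,\beta$ and $n\ge 0$ let $P_n^{\alpha,\beta}(x)=2^{-n}\sum_{j=0}^n\binom{n+\alpha}{j}\binom{n+\beta}{n-j}(x-1)^{n-j}(x+1)^j$, with generalized binomial coefficients $\binom{r}{j}=r(r-1)\cdots(r-j+1)/j!$, be the Jacobi polynomials. Write $\lambda(x)=x(x+\alpha+\beta+1)$ and $(a)_j=a(a+1)\cdots(a+j-1)$. Let $\mathcal F=(F_1,F_2)$ be a pair of finite sets of positive integers, $k_i=|F_i|$, $k=k_1+k_2$, and put $$u_{\mathcal F}=\sum_{f\in F_1}f+\sum_{f\in F_2}f-\binom{k_1+1}{2}-\binom{k_2}{2},\qquad \sigma_{\mathcal F}=\{u_{\mathcal F},u_{\mathcal F}+1,\dots\}\setminus\{u_{\mathcal F}+f: f\in F_1\}.$$ For $m\ge 0$ and $1\le j\le m$ set $a_{f,j}(x)=(-1)^{j-1}\bigl(P_f^{\alpha,\beta}\bigr)^{(j-1)}(x)$ and $b^{(m)}_{f,j}(x)=(\beta-f)_{j-1}(1+x)^{m-j}P_f^{\alpha+j-1,-\beta-j+1}(x)$. Let $\Omega_{\mathcal F}(x)=(1+x)^{-k_2(k_2-1)}\det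 M(x)$, where $M$ is the $k\times k$ matrix with rows $(a_{f,j})_{1\le j\le k}$ for $f\in F_1$, followed by $(b^{(k)}_{f,j})_{1\le j\le k}$ for $f\in F_2$; and for $n\in\sigma_{\mathcal F}$ let $P_n^{\alpha,\beta;\mathcal F}(x)=(1+x)^{-k_2(k_2-1)}\det M_n(x)$, where $M_n$ is the $(k+1)\times(k+1)$ matrix with first row $(a_{n-u_{\mathcal F},j})_{1\le j\le k+1}$, followed by $(a_{f,j})_{1\le j\le k+1}$ for $f\in F_1$ and $(b^{(k+1)}_{f,j})_{1\le j\le k+1}$ for $f\in F_2$ (elements of $F_1$ and of $F_2$ taken in increasing order). **Theorem.** Assume that none of $\alpha$, $\beta$, $\alpha+\beta$ belongs to $\{-1,-2,\dots\}$ and, if $F_2\neq\emptyset$, that neither $\alpha-\beta$ nor $\beta-\max F_2-1$ belongs to $\{-1,-2,\dots\}$. Then $\Omega_{\mathcal F}$ and $P_n^{\alpha,\beta;\mathcal F}$, $n\in\sigma_{\mathcal F}$, are nonzero polynomials, and the $P_n^{\alpha,\beta;\mathcal F}$, $n\in\sigma_{\mathcal F}$, are common eigenfunctions of the second-order differential operator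 $$D_{\mathcal F}=(1-x^2)\partial^2+h_1(x)\partial+h_0(x),\qquad \partial=\frac{d}{dx},$$ $$h_1(x)=\beta-\alpha-2k_2-(\alpha+\beta+2k_1+2)x-2(1-x^2)\frac{\Omega_{\mathcal F}'(x)}{\Omega_{\mathcal F}(x)},$$ $$h_0(x)=-\lambda(k_1)+\bigl[\alpha-\beta+2k_2+(2k_1+\alpha+\beta)x\bigr]\frac{\Omega_{\mathcal F}'(x)}{\Omega_{\mathcal F}(x)}+(1-x^2)\frac{\Omega_{\mathcal F}''(x)}{\Omega_{\mathcal F}(x)}.$$ More precisely, for every $n\in\sigma_{\mathcal F}$ and every real $x$ with $\Omega_{\mathcal F}(x)\ne0$, $$D_{\mathcal F}\bigl(P_n^{\alpha,\beta;\mathcal F}\bigr)(x)=-\lambda(n-u_{\mathcal F})\,P_n^{\alpha,\beta;\mathcal F}(x).$$ -/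

import Mathlib

open Polynomial

noncomputable section

namespace ExceptionalJacobi

/-- The Jacobi polynomial
`P_n^{α,β}(x) = 2^{-n} ∑_{j=0}^n binom(n+α, j) binom(n+β, n-j) (x-1)^{n-j} (x+1)^j`.
Here `Ring.choose r j = r (r-1) ⋯ (r-j+1) / j!` is the generalized binomial coefficient. -/
def jacobi (α β : ℝ) (n : ℕ) : ℝ[X] :=
  C ((2 : ℝ) ^ n)⁻¹ * ∑ j ∈ Finset.range (n + 1),
    C (Ring.choose ((n : ℝ) + α) j * Ring.choose ((n : ℝ) + β) (n - j)) *
      (X - 1) ^ (n - j) * (X + 1) ^ j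

/-- `λ^{α,β}(x) = x (x + α + β + 1)`. -/
def lam (α β x : ℝ) : ℝ := x * (x + α + β + 1)

/-- `u_F = ∑_{f ∈ F₁} f + ∑_{f ∈ F₂} f - binom(k₁+1, 2) - binom(k₂, 2)`.
When the elements of `F₁` and `F₂` are positive, the subtraction does not truncate. -/
def u (F₁ F₂ : Finset ℕ) : ℕ :=
  (∑ f ∈ F₁, f + ∑ f ∈ F₂, f) - ((F₁.card + 1).choose 2 + F₂.card.choose 2)

/-- `σ_F = {u_F, u_F + 1, …} \ {u_F + f : f ∈ F₁}`. -/
def sigma (F₁ F₂ : Finset ℕ) : Set ℕ :=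
  {n | u F₁ F₂ ≤ n} \ {n | ∃ f ∈ F₁, n = u F₁ F₂ + f}

/-- The row `((-1)^j (P_f^{α,β})^{(j)})`, `0 ≤ j < m` (columns are numbered from `0`). -/
def rowI (α β : ℝ) (m : ℕ) (f : ℕ) : Fin m → ℝ[X] :=
  fun j => (-1) ^ (j : ℕ) * derivative^[(j : ℕ)] (jacobi α β f)

/-- The row `((β-f)_j (1+x)^{m-1-j} P_f^{α+j,-β-j})`, `0 ≤ j < m` (columns are numbered
from `0`), where `(a)_j = a (a+1) ⋯ (a+j-1)`. -/
def rowII (α β : ℝ) (m : ℕ) (f : ℕ) : Fin m → ℝ[X] :=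
  fun j => C ((ascPochhammer ℝ (j : ℕ)).eval (β - f)) * (1 + X) ^ (m - 1 - (j : ℕ)) *
    jacobi (α + (j : ℕ)) (-β - (j : ℕ)) f

/-- The rows indexed by `f ∈ F₁`, in increasing order, followed by those indexed by `f ∈ F₂`,
in increasing order, each with `m` columns. -/
def rows (α β : ℝ) (F₁ F₂ : Finset ℕ) (m : ℕ) : Fin (F₁.card + F₂.card) → Fin m → ℝ[X] :=
  Fin.append (fun i => rowI α β m (F₁.orderEmbOfFin rfl i))
    (fun i => rowII α β m (F₂.orderEmbOfFin rfl i))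

/-- The determinant in the numerator of `Ω_F^{α,β}`, of size `k = k₁ + k₂`. -/
def OmegaNum (α β : ℝ) (F₁ F₂ : Finset ℕ) : ℝ[X] :=
  (Matrix.of (rows α β F₁ F₂ (F₁.card + F₂.card))).det

/-- The determinant in the numerator of `P_n^{α,β;F}`, of size `k + 1`. -/
def PNum (α β : ℝ) (F₁ F₂ : Finset ℕ) (n : ℕ) : ℝ[X] :=
  (Matrix.of (Fin.cons (rowI α β (F₁.card + F₂.card + 1) (n - u F₁ F₂))
    (rows α β F₁ F₂ (F₁.card + F₂.card + 1)) :
      Fin (F₁.card + F₂.card + 1) → Fin (F₁.card + F₂.card + 1) → ℝ[X])).det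

/-- The common denominator `(1+x)^{k₂(k₂-1)}`. -/
def denom (F₂ : Finset ℕ) : ℝ[X] := (1 + X) ^ (F₂.card * (F₂.card - 1))

/-- The polynomial `Ω_F^{α,β}`, a quotient of polynomials. -/
def Omega (α β : ℝ) (F₁ F₂ : Finset ℕ) : ℝ[X] := OmegaNum α β F₁ F₂ / denom F₂

/-- The polynomial `P_n^{α,β;F}`, a quotient of polynomials. -/
def P (α β : ℝ) (F₁ F₂ : Finset ℕ) (n : ℕ) : ℝ[X] := PNum α β F₁ F₂ n / denom F₂

/-- The coefficient of `∂` in `D_F`. -/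
def h₁ (α β : ℝ) (F₁ F₂ : Finset ℕ) (x : ℝ) : ℝ :=
  β - α - 2 * F₂.card - (α + β + 2 * F₁.card + 2) * x -
    2 * (1 - x ^ 2) *
      ((derivative (Omega α β F₁ F₂)).eval x / (Omega α β F₁ F₂).eval x)

/-- The coefficient of order zero in `D_F`. -/
def h₀ (α β : ℝ) (F₁ F₂ : Finset ℕ) (x : ℝ) : ℝ :=
  -lam α β F₁.card +
    (α - β + 2 * F₂.card + (2 * F₁.card + α + β) * x) *
      ((derivative (Omega α β F₁ F₂)).eval x / (Omega α β F₁ F₂).eval x) +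
    (1 - x ^ 2) *
      ((derivative (derivative (Omega α β F₁ F₂))).eval x / (Omega α β F₁ F₂).eval x)

/-- The differential operator `D_F = (1 - x²) ∂² + h₁ ∂ + h₀`; its coefficients are
defined where `Ω_F` does not vanish. -/
def D (α β : ℝ) (F₁ F₂ : Finset ℕ) (y : ℝ → ℝ) (x : ℝ) : ℝ :=
  (1 - x ^ 2) * deriv (deriv y) x + h₁ α β F₁ F₂ x * deriv y x + h₀ α β F₁ F₂ x * y x

end ExceptionalJacobi

end

/-! On `x > -1` the Jacobi operator `L = (1-x²)∂² + (β-α-(α+β+2)x)∂` has two families of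
eigenfunctions: `P_f^{α,β}` with eigenvalue `-λ(f)`, and `(1+x)^{-β} P_f^{α,-β}` with eigenvalue
`-λ(f-β)`. Up to a sign and a power of `1+x`, the determinant defining `Ω_F` is the Wronskian of the
eigenfunctions indexed by `F₁` and `F₂`, and the one defining `P_n` is the Wronskian with
`P_{n-u}^{α,β}` added. So the theorem is a Darboux–Crum statement.

It is proved without division, as an identity bilinear in the two Wronskians (`wr_bilinear`): the
eigenvalue equations, summed over the columns of each determinant, are combined by a Plücker
relation. `typed_bilinear` strips the powers of `1+x`; what remains is a polynomial identity valid
for `x > -1`, hence everywhere, and dividing it by `Ω_F` gives `D_F`.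

Exactness of the quotients and nonvanishing come from expanding the rows in powers of `1+x`
(`twistedWronskian_expansion`). Each term carries a Vandermonde determinant in the nodes `s_i -
r_i`, where `s_i` is the twist of row `i` and `r_i` the chosen exponent. Terms with repeated nodes
vanish, which bounds the exponent of `1+x` from below (`pow_dvd_typedDet`). The term of top degree
survives because the parameter conditions keep all degrees full and the nodes distinct
(`typedDet_ne_zero`). -/

noncomputable section

namespace ExceptionalJacobi

/-! ### Generalized binomial coefficients. -/

section Choose

theorem succ_mul_choose_succ (r : ℝ) (k : ℕ) :
    ((k : ℝ) + 1) * Ring.choose r (k + 1) = (r - k) * Ring.choose r k := by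
  have h := Ring.choose_smul_choose r (Nat.le_succ k)
  simp only [Nat.succ_eq_add_one, Nat.choose_succ_self_right, nsmul_eq_mul,
    Nat.add_sub_cancel_left, Ring.choose_one_right] at h
  push_cast at h
  linarith

theorem mul_choose_sub_one (r : ℝ) (k : ℕ) :
    r * Ring.choose (r - 1) k = (r - k) * Ring.choose r k := by
  rcases k with _ | k
  · simp
  · have h1 := Ring.choose_succ_succ (r - 1) k
    have h2 := succ_mul_choose_succ (r - 1) k
    rw [sub_add_cancel] at h1
    rw [h1]
    push_cast
    linarith

theorem choose_ne_zero_of_forall (r : ℝ) (n : ℕ) (h : ∀ i < n, r ≠ i) : Ring.choose r n ≠ 0 := by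
  induction n with
  | zero => simp
  | succ k ih =>
    have h1 := succ_mul_choose_succ r k
    have h2 : (r - k) * Ring.choose r k ≠ 0 :=
      mul_ne_zero (sub_ne_zero.2 (h k k.lt_succ_self)) (ih fun i hi => h i (by omega))
    exact right_ne_zero_of_mul (h1 ▸ h2)

end Choose

/-! ### Jacobi polynomials: contiguous relations, differential equation, leading coefficient. -/

section Jacobi

theorem jacobi_reflect (a b : ℝ) (n : ℕ) :
    jacobi a b n = (-1) ^ n * (jacobi b a n).comp (-X) := by
  simp only [jacobi, mul_comp, C_comp, Polynomial.sum_comp, pow_comp, sub_comp, add_comp, X_comp,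
    one_comp]
  rw [← Finset.sum_range_reflect, Finset.mul_sum, Finset.mul_sum, Finset.mul_sum]
  refine Finset.sum_congr rfl fun j hj => ?_
  have hj : j ≤ n := by simpa [Nat.lt_succ_iff] using hj
  rw [show n + 1 - 1 - j = n - j by omega, show n - (n - j) = j by omega]
  rw [show (-X - 1 : ℝ[X]) = (-1) * (X + 1) by ring, show (-X + 1 : ℝ[X]) = (-1) * (X - 1) by ring,
    mul_pow, mul_pow]
  have : ((-1 : ℝ[X]) ^ n) * ((-1) ^ (n - j) * (-1) ^ j) = 1 := by
    rw [← pow_add, Nat.sub_add_cancel hj, ← mul_pow]; simp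
  rw [mul_comm (Ring.choose _ _) (Ring.choose _ _)]
  linear_combination (-C ((2 : ℝ) ^ n)⁻¹ *
    C (Ring.choose ((n : ℝ) + b) j * Ring.choose ((n : ℝ) + a) (n - j)) *
      (X - 1) ^ j * (X + 1) ^ (n - j)) * this

theorem jacobi_raise (a b : ℝ) (n : ℕ) :
    (1 + X) * derivative (jacobi a b n) + C b * jacobi a b n =
      C (n + b) * jacobi (a + 1) (b - 1) n := by
  set A : ℕ → ℝ := fun j => Ring.choose ((n : ℝ) + a) j with hA
  set B : ℕ → ℝ := fun j => Ring.choose ((n : ℝ) + b) j with hB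
  have hder : (1 + X) * derivative (∑ j ∈ Finset.range (n + 1),
      C (A j * B (n - j)) * (X - 1) ^ (n - j) * (X + 1) ^ j) =
      ∑ j ∈ Finset.range (n + 1), C (((n - j : ℕ) : ℝ) * (A j * B (n - j))) *
        (X - 1) ^ (n - j - 1) * (X + 1) ^ (j + 1) +
      ∑ j ∈ Finset.range (n + 1), C ((j : ℝ) * (A j * B (n - j))) *
        (X - 1) ^ (n - j) * (X + 1) ^ j := by
    rw [derivative_sum, Finset.mul_sum, ← Finset.sum_add_distrib]
    refine Finset.sum_congr rfl fun j _ => ?_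
    simp only [derivative_mul, derivative_C, derivative_pow, derivative_sub, derivative_add,
      derivative_X, derivative_one, C_mul]
    rcases j with _ | j
    · simp; ring
    · simp only [Nat.add_sub_cancel]
      ring
  -- The term `j = n` drops out through its factor `n - j`, so the truncated exponent there is
  -- harmless.
  have hshift : ∑ j ∈ Finset.range (n + 1), C (((n - j : ℕ) : ℝ) * (A j * B (n - j))) *
        (X - 1) ^ (n - j - 1) * (X + 1) ^ (j + 1) =
      ∑ j ∈ Finset.range n, C (((n - j : ℕ) : ℝ) * (A j * B (n - j))) *
        (X - 1) ^ (n - (j + 1)) * (X + 1) ^ (j + 1) := by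
    rw [Finset.sum_range_succ]
    simp [Nat.sub_sub]
  have key : (1 + X) * derivative (∑ j ∈ Finset.range (n + 1),
      C (A j * B (n - j)) * (X - 1) ^ (n - j) * (X + 1) ^ j) +
      C b * (∑ j ∈ Finset.range (n + 1), C (A j * B (n - j)) * (X - 1) ^ (n - j) * (X + 1) ^ j) =
      C (n + b) * ∑ j ∈ Finset.range (n + 1),
        C (Ring.choose ((n : ℝ) + (a + 1)) j * Ring.choose ((n : ℝ) + (b - 1)) (n - j)) *
        (X - 1) ^ (n - j) * (X + 1) ^ j := by
    rw [hder, hshift, Finset.sum_range_succ' _ n, Finset.sum_range_succ' _ n,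
      Finset.sum_range_succ' _ n]
    rw [mul_add, mul_add, Finset.mul_sum, Finset.mul_sum,
      show ∀ p q r s t : ℝ[X], p + (q + r) + (s + t) = (p + (q + s)) + (r + t) from
        fun _ _ _ _ _ => by ring, ← Finset.sum_add_distrib, ← Finset.sum_add_distrib]
    congr 1
    · refine Finset.sum_congr rfl fun j hj => ?_
      have hj : j < n := Finset.mem_range.1 hj
      have h1 := succ_mul_choose_succ ((n : ℝ) + b) (n - (j + 1))
      have h2 := mul_choose_sub_one ((n : ℝ) + b) (n - (j + 1))
      have h3 := Ring.choose_succ_succ ((n : ℝ) + a) j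
      have e1 : n - (j + 1) + 1 = n - j := by omega
      have e2 : ((n - (j + 1) : ℕ) : ℝ) = n - j - 1 := by
        rw [Nat.cast_sub hj]; push_cast; ring
      have e3 : ((n - j : ℕ) : ℝ) = n - j := Nat.cast_sub hj.le
      rw [e1, e2] at h1
      rw [e2] at h2
      rw [e3, ← add_assoc (n : ℝ) a 1, h3, ← add_sub_assoc]
      have hc : ((n : ℝ) - j) * (A j * B (n - j)) +
          (((j + 1 : ℕ) : ℝ) * (A (j + 1) * B (n - (j + 1))) + b * (A (j + 1) * B (n - (j + 1)))) =
          (n + b) * ((A j + A (j + 1)) * Ring.choose ((n : ℝ) + b - 1) (n - (j + 1))) := by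
        simp only [hA, hB]
        push_cast
        linear_combination Ring.choose ((n : ℝ) + a) j * h1 -
          (Ring.choose ((n : ℝ) + a) j + Ring.choose ((n : ℝ) + a) (j + 1)) * h2
      have hc' := congrArg (C : ℝ → ℝ[X]) hc
      rw [C_add, C_add, C_mul (a := b), C_mul (a := (n : ℝ) + b)] at hc'
      linear_combination (X - 1) ^ (n - (j + 1)) * (X + 1) ^ (j + 1) * hc'
    · have h2 := mul_choose_sub_one ((n : ℝ) + b) n
      have hc : b * (A 0 * B n) = (n + b) * (1 * Ring.choose ((n : ℝ) + b - 1) n) := by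
        simp only [hA, hB, Ring.choose_zero_right]
        linear_combination -h2
      have hc' := congrArg (C : ℝ → ℝ[X]) hc
      simp only [Nat.cast_zero, zero_mul, C_0, zero_add, Ring.choose_zero_right, Nat.sub_zero,
        ← add_sub_assoc]
      rw [C_mul (a := b), C_mul (a := (n : ℝ) + b)] at hc'
      linear_combination (X - 1) ^ n * (X + 1) ^ 0 * hc'
  simp only [jacobi, derivative_C_mul]
  linear_combination C ((2 : ℝ) ^ n)⁻¹ * key

theorem jacobi_lower (a b : ℝ) (n : ℕ) :
    (1 - X) * derivative (jacobi a b n) - C a * jacobi a b n =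
      -C (n + a) * jacobi (a - 1) (b + 1) n := by
  have h := congrArg (fun p : ℝ[X] => p.comp (-X)) (jacobi_raise b a n)
  simp only [add_comp, mul_comp, X_comp, one_comp, C_comp] at h
  rw [jacobi_reflect a b, jacobi_reflect (a - 1) (b + 1)]
  have hd : derivative ((-1 : ℝ[X]) ^ n) = 0 := by
    rw [show (-1 : ℝ[X]) ^ n = C ((-1) ^ n) by simp, derivative_C]
  rw [derivative_mul, derivative_comp, hd, derivative_neg, derivative_X]
  linear_combination (-1) * (-1) ^ n * h

/-- The second-order operator factors: raising to `(a+1, b-1)` and lowering again returns to `(a,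
b)`. -/
theorem jacobi_ode (a b : ℝ) (n : ℕ) :
    (1 - X ^ 2) * derivative (derivative (jacobi a b n)) +
      (C (b - a) - C (a + b + 2) * X) * derivative (jacobi a b n) +
      C (n * (n + a + b + 1)) * jacobi a b n = 0 := by
  have h1 := jacobi_raise a b n
  have h2 := jacobi_lower (a + 1) (b - 1) n
  rw [add_sub_cancel_right, sub_add_cancel] at h2
  have h3 := congrArg derivative h1
  simp only [derivative_add, derivative_mul, derivative_C, derivative_X, derivative_one] at h3
  simp only [C_add, C_sub, C_mul, C_1, map_ofNat] at *
  linear_combination (1 - X) * h3 - (C a + 1) * h1 + (C (n : ℝ) + C b) * h2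

theorem natDegree_jacobi_le (a b : ℝ) (n : ℕ) : (jacobi a b n).natDegree ≤ n := by
  refine (natDegree_C_mul_le _ _).trans (natDegree_sum_le_of_forall_le _ _ fun j hj => ?_)
  have hj : j ≤ n := by simpa [Nat.lt_succ_iff] using hj
  have h1 : ((X : ℝ[X]) - 1).natDegree ≤ 1 := by
    rw [show (X : ℝ[X]) - 1 = X - C 1 by simp]; exact (natDegree_X_sub_C _).le
  have h2 : ((X : ℝ[X]) + 1).natDegree ≤ 1 := by
    rw [show (X : ℝ[X]) + 1 = X + C 1 by simp]; exact (natDegree_X_add_C _).le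
  refine natDegree_mul_le.trans ?_
  have h3 := natDegree_C_mul_le (Ring.choose ((n : ℝ) + a) j * Ring.choose ((n : ℝ) + b) (n - j))
    ((X - 1 : ℝ[X]) ^ (n - j))
  have h4 := natDegree_pow_le_of_le (n - j) h1
  have h5 := natDegree_pow_le_of_le j h2
  omega

/-- Each product `(X-1)^(n-j) (X+1)^j` is monic of degree `n`, so the coefficients add up by
Chu–Vandermonde. -/
theorem coeff_jacobi (a b : ℝ) (n : ℕ) :
    (jacobi a b n).coeff n = ((2 : ℝ) ^ n)⁻¹ * Ring.choose (2 * n + a + b) n := by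
  rw [jacobi, coeff_C_mul, finsetSum_coeff,
    show 2 * (n : ℝ) + a + b = (n + a) + (n + b) by ring, Ring.add_choose_eq n (Commute.all _ _),
    Finset.Nat.sum_antidiagonal_eq_sum_range_succ
      fun i j => Ring.choose ((n : ℝ) + a) i * Ring.choose ((n : ℝ) + b) j]
  congr 1
  refine Finset.sum_congr rfl fun j hj => ?_
  have hj : j ≤ n := by simpa [Nat.lt_succ_iff] using hj
  rw [mul_assoc, coeff_C_mul]
  have hm : ((X - 1 : ℝ[X]) ^ (n - j) * (X + 1) ^ j).Monic := by
    rw [show (X : ℝ[X]) - 1 = X - C 1 by simp, show (X : ℝ[X]) + 1 = X + C 1 by simp]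
    exact ((monic_X_sub_C _).pow _).mul ((monic_X_add_C _).pow _)
  have hd : ((X - 1 : ℝ[X]) ^ (n - j) * (X + 1) ^ j).natDegree = n := by
    rw [show (X : ℝ[X]) - 1 = X - C 1 by simp, show (X : ℝ[X]) + 1 = X + C 1 by simp,
      ((monic_X_sub_C _).pow _).natDegree_mul ((monic_X_add_C _).pow _), natDegree_pow,
      natDegree_pow, natDegree_X_sub_C, natDegree_X_add_C]
    omega
  have := hm.coeff_natDegree
  rw [hd] at this
  rw [this, mul_one]

theorem coeff_jacobi_ne_zero (a b : ℝ) (n : ℕ) (h : ∀ m : ℕ, 1 ≤ m → a + b ≠ -(m : ℝ)) :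
    (jacobi a b n).coeff n ≠ 0 := by
  rw [coeff_jacobi]
  refine mul_ne_zero (by positivity) (choose_ne_zero_of_forall _ _ fun i hi he => ?_)
  refine h (2 * n - i) (by omega) ?_
  rw [Nat.cast_sub (by omega)]
  push_cast
  linarith

theorem natDegree_jacobi (a b : ℝ) (n : ℕ) (h : ∀ m : ℕ, 1 ≤ m → a + b ≠ -(m : ℝ)) :
    (jacobi a b n).natDegree = n :=
  natDegree_eq_of_le_of_coeff_ne_zero (natDegree_jacobi_le a b n) (coeff_jacobi_ne_zero a b n h)

theorem jacobi_ne_zero (a b : ℝ) (n : ℕ) (h : ∀ m : ℕ, 1 ≤ m → a + b ≠ -(m : ℝ)) :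
    jacobi a b n ≠ 0 := fun h0 => coeff_jacobi_ne_zero a b n h (by simp [h0])

end Jacobi

/-! ### Derivatives of `(1+x)^{-s} q` with the powers of `1+x` cleared. -/

section TwistedDerivative

/-- The polynomial `(1+x)^{s+j} (-d/dx)^j ((1+x)^{-s} q)`. -/
def twistedDeriv (s : ℝ) : ℕ → ℝ[X] → ℝ[X]
  | 0, q => q
  | j + 1, q => C (s + j) * twistedDeriv s j q - (1 + X) * derivative (twistedDeriv s j q)

theorem twistedDeriv_zero_left (j : ℕ) (q : ℝ[X]) :
    twistedDeriv 0 j q = (1 + X) ^ j * ((-1) ^ j * derivative^[j] q) := by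
  induction j with
  | zero => simp [twistedDeriv]
  | succ j ih =>
    have hd : derivative ((-1 : ℝ[X]) ^ j) = 0 := by
      rw [show (-1 : ℝ[X]) ^ j = C ((-1) ^ j) by simp, derivative_C]
    have hX : (1 + X) * derivative ((1 + X : ℝ[X]) ^ j) = C (j : ℝ) * (1 + X) ^ j := by
      rcases j with _ | j
      · simp
      · rw [derivative_pow]
        simp
        ring
    rw [twistedDeriv, ih, derivative_mul, derivative_mul, hd, Function.iterate_succ_apply', zero_add]
    linear_combination (-(-1) ^ j * derivative^[j] q) * hX

/-- Powers of `1+x` are eigenvectors: `(-d/dx)^j (1+x)^{d-s} = (s-d)_j (1+x)^{d-s-j}`. -/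
theorem twistedDeriv_sum (s : ℝ) (j N : ℕ) (c : ℕ → ℝ) :
    twistedDeriv s j (∑ d ∈ Finset.range N, C (c d) * (1 + X) ^ d) =
      ∑ d ∈ Finset.range N, C (c d * (ascPochhammer ℝ j).eval (s - d)) * (1 + X) ^ d := by
  induction j with
  | zero => simp [twistedDeriv]
  | succ j ih =>
    rw [twistedDeriv, ih, derivative_sum, Finset.mul_sum, Finset.mul_sum, ← Finset.sum_sub_distrib]
    refine Finset.sum_congr rfl fun d _ => ?_
    have hX : (1 + X) * derivative ((1 + X : ℝ[X]) ^ d) = C (d : ℝ) * (1 + X) ^ d := by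
      rcases d with _ | d
      · simp
      · rw [derivative_pow]
        simp
        ring
    rw [ascPochhammer_succ_eval, derivative_C_mul]
    simp only [C_mul, C_add, C_sub]
    linear_combination (-C (c d) * C ((ascPochhammer ℝ j).eval (s - d))) * hX

/-- Each differentiation is one use of `jacobi_raise`. This is what turns the rows of type II into
derivatives of `(1+x)^{-β} P_f^{α,-β}`. -/
theorem twistedDeriv_jacobi (a b : ℝ) (n j : ℕ) :
    twistedDeriv b j (jacobi a (-b) n) =
      C ((ascPochhammer ℝ j).eval (b - n)) * jacobi (a + j) (-b - j) n := by
  induction j with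
  | zero => simp [twistedDeriv]
  | succ j ih =>
    have h := jacobi_raise (a + j) (-b - j) n
    rw [twistedDeriv, ih, ascPochhammer_succ_eval, derivative_C_mul]
    push_cast
    rw [← add_assoc, ← sub_sub]
    simp only [C_mul, C_add, C_sub, C_neg] at h ⊢
    linear_combination (-C ((ascPochhammer ℝ j).eval (b - n))) * h

theorem exists_expansion (q : ℝ[X]) : ∃ c : ℕ → ℝ,
    q = ∑ d ∈ Finset.range (q.natDegree + 1), C (c d) * (1 + X) ^ d ∧
      c q.natDegree = q.leadingCoeff := by
  refine ⟨(taylor (-1) q).coeff, ?_, coeff_taylor_natDegree _ _⟩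
  have h := sum_taylor_eq q (-1)
  rw [sum_over_range _ (by simp), natDegree_taylor] at h
  conv_lhs => rw [← h]
  refine Finset.sum_congr rfl fun d _ => ?_
  rw [C_neg, sub_neg_eq_add, C_1, add_comm X]

end TwistedDerivative

/-! ### Divisibility by powers of `1+x` and nonvanishing. -/

section Determinants

/-- Rising factorials are monic of degree `j`, so this is the Vandermonde determinant. -/
theorem det_ascPochhammer_ne_zero_iff {m : ℕ} (v : Fin m → ℝ) :
    (Matrix.of fun i j : Fin m => (ascPochhammer ℝ (j : ℕ)).eval (v i)).det ≠ 0 ↔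
      Function.Injective v := by
  rw [← Matrix.det_eval_matrixOfPolynomials_eq_det_vandermonde v
    (fun j => ascPochhammer ℝ (j : ℕ)) (fun j => ascPochhammer_natDegree (S := ℝ) (j : ℕ))
    (fun j => monic_ascPochhammer ℝ j), Matrix.det_vandermonde_ne_zero_iff]

/-- The determinant with rows `(1+x)^{m-1-j} (1+x)^{s+j} (-d/dx)^j ((1+x)^{-s} q)`. -/
def twistedWronskian {m : ℕ} (s : Fin m → ℝ) (q : Fin m → ℝ[X]) : ℝ[X] :=
  (Matrix.of fun i j : Fin m => (1 + X) ^ (m - 1 - (j : ℕ)) * twistedDeriv (s i) j (q i)).det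

theorem twistedWronskian_expansion {m : ℕ} (s : Fin m → ℝ) (N : Fin m → ℕ)
    (c : Fin m → ℕ → ℝ) :
    twistedWronskian s (fun i => ∑ d ∈ Finset.range (N i), C (c i d) * (1 + X) ^ d) =
      ∑ r ∈ Fintype.piFinset (fun i => Finset.range (N i)),
        C ((∏ i, c i (r i)) * (Matrix.of fun i j : Fin m =>
          (ascPochhammer ℝ (j : ℕ)).eval (s i - r i)).det) *
        (1 + X) ^ (∑ i, r i + ∑ j : Fin m, (m - 1 - (j : ℕ))) := by
  have h1 : (Matrix.of fun i j : Fin m => (1 + X : ℝ[X]) ^ (m - 1 - (j : ℕ)) *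
      twistedDeriv (s i) j (∑ d ∈ Finset.range (N i), C (c i d) * (1 + X) ^ d)) =
      fun i => ∑ d ∈ Finset.range (N i), (fun j : Fin m => (C (c i d) * (1 + X) ^ d) *
        ((1 + X) ^ (m - 1 - (j : ℕ)) * C ((ascPochhammer ℝ (j : ℕ)).eval (s i - d)))) := by
    funext i j
    rw [Matrix.of_apply, twistedDeriv_sum, Finset.mul_sum, Finset.sum_apply]
    refine Finset.sum_congr rfl fun d _ => ?_
    rw [C_mul]
    ring
  rw [twistedWronskian, h1]
  change (Matrix.detRowAlternating (R := ℝ[X]) (n := Fin m)).toMultilinearMap _ = _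
  rw [MultilinearMap.map_sum_finset]
  refine Finset.sum_congr rfl fun r _ => ?_
  change (Matrix.of fun i j : Fin m => (C (c i (r i)) * (1 + X : ℝ[X]) ^ (r i)) *
    (Matrix.of fun i j : Fin m => ((1 + X : ℝ[X]) ^ (m - 1 - (j : ℕ)) *
      (Matrix.of fun i j : Fin m => C ((ascPochhammer ℝ (j : ℕ)).eval (s i - r i))) i j)) i j).det = _
  rw [Matrix.det_mul_column, Matrix.det_mul_row, Finset.prod_mul_distrib,
    Finset.prod_pow_eq_pow_sum, Finset.prod_pow_eq_pow_sum, C_mul, map_prod, RingHom.map_det,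
    pow_add]
  have : (C.mapMatrix (Matrix.of fun i j : Fin m => (ascPochhammer ℝ (j : ℕ)).eval (s i - r i)) :
      Matrix (Fin m) (Fin m) ℝ[X]) =
      Matrix.of fun i j : Fin m => C ((ascPochhammer ℝ (j : ℕ)).eval (s i - r i)) := rfl
  rw [this]
  ring

theorem twistedWronskian_ne_zero {m : ℕ} (s : Fin m → ℝ) (q : Fin m → ℝ[X]) (hq : ∀ i, q i ≠ 0)
    (hs : Function.Injective fun i => s i - (q i).natDegree) : twistedWronskian s q ≠ 0 := by
  choose c hc hlead using fun i => exists_expansion (q i)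
  have h := twistedWronskian_expansion s (fun i => (q i).natDegree + 1) c
  rw [← funext hc] at h
  intro h0
  rw [h0] at h
  -- Substituting `X - 1` turns powers of `1+X` into powers of `X`; the coefficient read off is the
  -- highest possible one, reached only when every row contributes its leading term.
  have h2 := congrArg (fun p : ℝ[X] => (p.comp (X - 1)).coeff
    (∑ i, (q i).natDegree + ∑ j : Fin m, (m - 1 - (j : ℕ)))) h
  simp only [zero_comp, coeff_zero, Polynomial.sum_comp, mul_comp, C_comp, pow_comp, add_comp,
    one_comp, X_comp, add_sub_cancel, finsetSum_coeff, coeff_C_mul, coeff_X_pow] at h2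
  rw [Finset.sum_eq_single fun i => (q i).natDegree] at h2
  · rw [if_pos rfl, mul_one, eq_comm, mul_eq_zero] at h2
    rcases h2 with h2 | h2
    · obtain ⟨i, _, hi⟩ := Finset.prod_eq_zero_iff.1 h2
      exact hq i (leadingCoeff_eq_zero.1 (hlead i ▸ hi))
    · exact (det_ascPochhammer_ne_zero_iff _).2 hs h2
  · intro r hr hne
    have hle : ∀ i, r i ≤ (q i).natDegree := fun i => by
      have := Fintype.mem_piFinset.1 hr i
      simpa [Nat.lt_succ_iff] using this
    have hlt : ∑ i, r i < ∑ i, (q i).natDegree := by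
      obtain ⟨i, hi⟩ := Function.ne_iff.1 hne
      exact Finset.sum_lt_sum (fun i _ => hle i) ⟨i, Finset.mem_univ i, lt_of_le_of_ne (hle i) hi⟩
    rw [if_neg (by omega), mul_zero]
  · intro hn
    exact absurd (Fintype.mem_piFinset.2 fun i => by simp) hn

/-- Among sets of `c` distinct naturals, `{0, …, c-1}` has the least sum. -/
theorem card_mul_pred_le_two_mul_sum (S : Finset ℕ) : S.card * (S.card - 1) ≤ 2 * ∑ x ∈ S, x := by
  induction S using Finset.induction_on_max with
  | empty => simp
  | insert a S hS ih =>
    have ha : a ∉ S := fun h => (hS a h).false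
    rw [Finset.card_insert_of_notMem ha, Finset.sum_insert ha, Nat.add_sub_cancel]
    have hc : S.card ≤ a := by
      have : S ⊆ Finset.range a := fun x hx => Finset.mem_range.2 (hS x hx)
      simpa using Finset.card_le_card this
    rcases h : S.card with _ | k
    · simp
    · rw [h] at ih hc
      simp only [Nat.add_sub_cancel] at ih
      nlinarith

theorem card_mul_pred_le_two_mul_sum_of_injOn {ι : Type*} (T : Finset ι) (d : ι → ℕ)
    (hd : Set.InjOn d T) : T.card * (T.card - 1) ≤ 2 * ∑ i ∈ T, d i := by
  classical
  have h := card_mul_pred_le_two_mul_sum (T.image d)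
  rwa [Finset.card_image_of_injOn hd, Finset.sum_image hd] at h

theorem two_mul_sum_sub (m : ℕ) : 2 * ∑ j : Fin m, (m - 1 - (j : ℕ)) = m * (m - 1) := by
  rw [Fin.sum_univ_eq_sum_range (fun j => m - 1 - j), Finset.sum_range_reflect (fun j => j), mul_comm,
    Finset.sum_range_id_mul_two]

/-- The exponent `s` of the twist `(1+x)^{-s}` of a row of type I (`false`) or II (`true`). -/
def twist (β : ℝ) (b : Bool) : ℝ := if b then β else 0

/-- A row of type I (`false`) or II (`true`) built from the polynomial `q`. -/
def typedRow (β : ℝ) (m : ℕ) : Bool → ℝ[X] → Fin m → ℝ[X]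
  | false, q => fun j => (-1) ^ (j : ℕ) * derivative^[(j : ℕ)] q
  | true, q => fun j => (1 + X) ^ (m - 1 - (j : ℕ)) * twistedDeriv β j q

/-- The determinant of a matrix whose rows have type I or II. -/
def typedDet {m : ℕ} (β : ℝ) (τ : Fin m → Bool) (q : Fin m → ℝ[X]) : ℝ[X] :=
  (Matrix.of fun i j : Fin m => typedRow β m (τ i) (q i) j).det

variable {m : ℕ} (β : ℝ) (τ : Fin m → Bool) (q : Fin m → ℝ[X])

/-- A row of type I is missing the factor `(1+x)^(m-1)` that a uniform twisted row with `s = 0`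
carries. -/
theorem twistedWronskian_twist :
    twistedWronskian (fun i => twist β (τ i)) q =
      (1 + X) ^ ((m - 1) * (Finset.univ.filter fun i => τ i = false).card) * typedDet β τ q := by
  have h : (Matrix.of fun i j : Fin m => (1 + X : ℝ[X]) ^ (m - 1 - (j : ℕ)) *
      twistedDeriv (twist β (τ i)) j (q i)) =
      Matrix.of fun i j : Fin m => (if τ i = false then (1 + X) ^ (m - 1) else 1) *
        (Matrix.of fun i j : Fin m => typedRow β m (τ i) (q i) j) i j := by
    ext1 i j
    simp only [Matrix.of_apply]
    cases τ i
    · have hj : m - 1 - (j : ℕ) + j = m - 1 := Nat.sub_add_cancel (by omega)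
      simp only [twist, typedRow, Bool.false_eq_true, if_false, if_true, twistedDeriv_zero_left]
      rw [← mul_assoc, ← pow_add, hj]
    · simp [twist, typedRow]
  rw [twistedWronskian, h, Matrix.det_mul_column, typedDet, Finset.prod_ite, Finset.prod_const,
    Finset.prod_const_one, mul_one, pow_mul]

/-- In a nonzero term of the expansion the exponents are distinct within each type, so they sum to
at least `a(a-1)/2 + b(b-1)/2`. Adding the `m(m-1)/2` from the columns, with `m = a + b`, gives the
stated power. -/
theorem pow_dvd_twistedWronskian (a b : ℕ)
    (ha : (Finset.univ.filter fun i => τ i = false).card = a)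
    (hb : (Finset.univ.filter fun i => ¬ τ i = false).card = b) :
    (1 + X) ^ ((m - 1) * a + b * (b - 1)) ∣ twistedWronskian (fun i => twist β (τ i)) q := by
  choose c hc _ using fun i => exists_expansion (q i)
  rw [funext hc, twistedWronskian_expansion]
  refine Finset.dvd_sum fun r _ => ?_
  by_cases hr : Function.Injective fun i => twist β (τ i) - r i
  · refine Dvd.dvd.mul_left (pow_dvd_pow _ ?_) _
    have hinj : ∀ v : Bool → Prop, (∀ x y, v x → v y → x = y) →
        Set.InjOn r {i | v (τ i)} := by
      intro v hv i hi j hj hij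
      refine hr ?_
      simp only [hij, hv _ _ hi hj]
    have h1 := card_mul_pred_le_two_mul_sum_of_injOn (Finset.univ.filter fun i => τ i = false) r
      (by simpa using hinj (fun x => x = false) (by rintro x y rfl rfl; rfl))
    have h2 := card_mul_pred_le_two_mul_sum_of_injOn (Finset.univ.filter fun i => ¬ τ i = false) r
      (by simpa using hinj (fun x => x = true) (by rintro x y rfl rfl; rfl))
    have h3 := two_mul_sum_sub m
    have h4 := Finset.sum_filter_add_sum_filter_not Finset.univ (fun i => τ i = false) r
    have h5 : a + b = m := by
      rw [← ha, ← hb, Finset.card_filter_add_card_filter_not]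
      simp
    rw [ha] at h1
    rw [hb] at h2
    have hz : ∀ n : ℕ, ((n * (n - 1) : ℕ) : ℤ) = n * (n - 1) := by
      intro n
      rcases n with _ | n <;> simp
    rw [← h4]
    have hm : (((m - 1) * a : ℕ) : ℤ) = (m - 1) * a := by
      rcases m with _ | m
      · have : a = 0 := by omega
        simp [this]
      · simp
    zify at h1 h2 h3 h5 ⊢
    have hz1 := hz a
    have hz2 := hz b
    have hz3 := hz m
    push_cast at hz1 hz2 hz3 hm h1 h2 h3 ⊢
    rw [hz1] at h1
    rw [hz2] at h2 ⊢
    rw [hz3] at h3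
    rw [hm]
    have : ((m : ℤ) - 1) * a + b * (b - 1) = (m * (m - 1) + a * (a - 1) + b * (b - 1)) / 2 := by
      rw [← h5]
      refine (Int.ediv_eq_of_eq_mul_right two_ne_zero ?_).symm
      ring
    omega
  · have : (Matrix.of fun i j : Fin m =>
        (ascPochhammer ℝ (j : ℕ)).eval (twist β (τ i) - r i)).det = 0 := by
      by_contra h
      exact hr ((det_ascPochhammer_ne_zero_iff _).1 h)
    rw [this, mul_zero, C_0, zero_mul]
    exact dvd_zero _

theorem one_add_X_ne_zero : (1 + X : ℝ[X]) ≠ 0 := by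
  rw [add_comm]
  exact X_add_C_ne_zero (1 : ℝ)

theorem pow_dvd_typedDet (b : ℕ) (hb : (Finset.univ.filter fun i => ¬ τ i = false).card = b) :
    (1 + X) ^ (b * (b - 1)) ∣ typedDet β τ q := by
  have h := pow_dvd_twistedWronskian β τ q _ b rfl hb
  rw [twistedWronskian_twist, pow_add] at h
  exact (mul_dvd_mul_iff_left (pow_ne_zero _ one_add_X_ne_zero)).1 h

theorem typedDet_ne_zero (hq : ∀ i, q i ≠ 0)
    (hs : Function.Injective fun i => twist β (τ i) - (q i).natDegree) : typedDet β τ q ≠ 0 := by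
  have h := twistedWronskian_ne_zero (fun i => twist β (τ i)) q hq hs
  rw [twistedWronskian_twist] at h
  exact right_ne_zero_of_mul h

end Determinants

/-! ### Determinants with selected columns. -/

section ColumnDeterminants

/-- The determinant formed by the columns of `Y` with the given indices. -/
def colDet {n : ℕ} (Y : Fin n → ℕ → ℝ) (c : Fin n → ℕ) : ℝ :=
  (Matrix.of fun i j : Fin n => Y i (c j)).det

variable {n : ℕ} (Y : Fin n → ℕ → ℝ)

theorem colDet_update (c : Fin n → ℕ) (k : Fin n) (l : ℕ) :
    colDet Y (Function.update c k l) =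
      ((Matrix.of fun i j : Fin n => Y i (c j)).updateCol k fun i => Y i l).det := by
  unfold colDet
  congr 1
  ext i j
  by_cases h : j = k
  · subst h; simp
  · simp [h]

theorem colDet_eq_zero (c : Fin n → ℕ) {a b : Fin n} (hab : a ≠ b) (h : c a = c b) :
    colDet Y c = 0 :=
  Matrix.det_zero_of_column_eq hab fun i => by simp [h]

theorem colDet_swap (c : Fin n → ℕ) {a b : Fin n} (hab : a ≠ b) :
    colDet Y (c ∘ Equiv.swap a b) = -colDet Y c := by
  have h := Matrix.det_permute' (Equiv.swap a b) (Matrix.of fun i j : Fin n => Y i (c j))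
  rw [Equiv.Perm.sign_swap hab] at h
  rw [Units.val_neg, Units.val_one, Int.cast_neg, Int.cast_one, neg_one_mul] at h
  exact h

theorem hasDerivAt_colDet (Y : Fin n → ℕ → ℝ → ℝ) (x : ℝ)
    (hY : ∀ i j, HasDerivAt (Y i j) (Y i (j + 1) x) x) (c : Fin n → ℕ) :
    HasDerivAt (fun x => colDet (fun i j => Y i j x) c)
      (∑ k, colDet (fun i j => Y i j x) (Function.update c k (c k + 1))) x := by
  unfold colDet
  simp only [Matrix.det_apply, Matrix.of_apply]
  have hs : ∀ σ : Equiv.Perm (Fin n), HasDerivAt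
      (fun x => Equiv.Perm.sign σ • ∏ i, Y (σ i) (c i) x)
      (Equiv.Perm.sign σ • ∑ k, ∏ i, Y (σ i) (Function.update c k (c k + 1) i) x) x := by
    intro σ
    have h := HasDerivAt.fun_finsetProd (u := Finset.univ) (x := x)
      (f := fun j => Y (σ j) (c j)) (f' := fun j => Y (σ j) (c j + 1) x) fun j _ => hY _ _
    have h2 := h.const_smul (Equiv.Perm.sign σ)
    convert! h2 using 2
    refine Finset.sum_congr rfl fun k _ => ?_
    rw [← Finset.mul_prod_erase _ _ (Finset.mem_univ k), Function.update_self, smul_eq_mul,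
      mul_comm]
    congr 1
    refine Finset.prod_congr rfl fun j hj => ?_
    rw [Function.update_of_ne (Finset.ne_of_mem_erase hj)]
  have h := HasDerivAt.fun_sum fun σ (_ : σ ∈ Finset.univ) => hs σ
  simp only [Finset.smul_sum] at h
  rwa [Finset.sum_comm] at h

/-- The infinitesimal form of `det (diag(d) M) = (∏ d_i) det M`: a diagonal matrix acts on the
determinant through its trace. -/
theorem sum_det_updateCol_mul (l : Fin n → ℝ) (M : Matrix (Fin n) (Fin n) ℝ) :
    ∑ k, (M.updateCol k fun i => l i * M i k).det = (∑ i, l i) * M.det := by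
  simp only [Matrix.det_apply]
  rw [Finset.sum_comm, Finset.mul_sum]
  refine Finset.sum_congr rfl fun σ _ => ?_
  rw [← Finset.smul_sum, mul_smul_comm]
  congr 1
  rw [← Equiv.sum_comp σ l, Finset.sum_mul]
  refine Finset.sum_congr rfl fun k _ => ?_
  rw [← Finset.mul_prod_erase _ _ (Finset.mem_univ k),
    ← Finset.mul_prod_erase Finset.univ (fun i => M (σ i) i) (Finset.mem_univ k),
    Matrix.updateCol_self, mul_assoc]
  congr 2
  refine Finset.prod_congr rfl fun j hj => ?_
  rw [Matrix.updateCol_ne (Finset.ne_of_mem_erase hj)]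

end ColumnDeterminants

/-! ### Wronskians and the bilinear Darboux–Crum identity. -/

section Wronskian

/-- The Wronskian. -/
def wr {n : ℕ} (Y : Fin n → ℕ → ℝ) : ℝ := colDet Y fun j => j

/-- The derivative of the Wronskian. -/
def wr' {n : ℕ} (Y : Fin n → ℕ → ℝ) : ℝ :=
  ∑ k : Fin n, if (k : ℕ) + 1 = n then
    colDet Y (Function.update (fun j : Fin n => (j : ℕ)) k (k + 1)) else 0

/-- The second derivative of the Wronskian. -/
def wr'' {n : ℕ} (Y : Fin n → ℕ → ℝ) : ℝ :=
  ∑ k : Fin n, if (k : ℕ) + 1 = n then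
    ∑ l, colDet Y (Function.update (Function.update (fun j : Fin n => (j : ℕ)) k (k + 1)) l
      (Function.update (fun j : Fin n => (j : ℕ)) k (k + 1) l + 1)) else 0

variable {r : ℕ}

theorem colDet_update_castSucc (Y : Fin (r + 1) → ℕ → ℝ) (i : Fin r) :
    colDet Y (Function.update (fun j : Fin (r + 1) => (j : ℕ)) i.castSucc (i + 1)) = 0 := by
  refine colDet_eq_zero Y _ (a := i.castSucc) (b := i.succ) (Fin.castSucc_lt_succ).ne ?_
  rw [Function.update_self, Function.update_of_ne (Fin.castSucc_lt_succ).ne']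
  simp

theorem wr'_eq (Y : Fin (r + 1) → ℕ → ℝ) :
    wr' Y = colDet Y (Function.update (fun j : Fin (r + 1) => (j : ℕ)) (Fin.last r) (r + 1)) := by
  rw [wr', Fin.sum_univ_castSucc, Finset.sum_eq_zero, zero_add, Fin.val_last, if_pos rfl]
  exact fun i _ => if_neg (by rw [Fin.val_castSucc]; omega)

theorem wr''_eq (Y : Fin (r + 1) → ℕ → ℝ) :
    wr'' Y = colDet Y (Function.update (fun j : Fin (r + 1) => (j : ℕ)) (Fin.last r) (r + 2)) +
      ∑ i : Fin r, colDet Y (Function.update (Function.update (fun j : Fin (r + 1) => (j : ℕ))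
        (Fin.last r) (r + 1)) i.castSucc (i + 1)) := by
  rw [wr'', Fin.sum_univ_castSucc, Finset.sum_eq_zero, zero_add, Fin.val_last, if_pos rfl,
    Fin.sum_univ_castSucc, add_comm, Function.update_self, Function.update_idem]
  · congr 1
    refine Finset.sum_congr rfl fun i _ => ?_
    rw [Function.update_of_ne (Fin.castSucc_lt_last i).ne, Fin.val_castSucc]
  · exact fun i _ => if_neg (by rw [Fin.val_castSucc]; omega)

theorem hasDerivAt_wr {n : ℕ} (Y : Fin n → ℕ → ℝ → ℝ) (x : ℝ)
    (hY : ∀ i j, HasDerivAt (Y i j) (Y i (j + 1) x) x) :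
    HasDerivAt (fun x => wr fun i j => Y i j x) (wr' fun i j => Y i j x) x := by
  have h := hasDerivAt_colDet Y x hY fun j => j
  have e : ∑ k : Fin n, colDet (fun i j => Y i j x)
      (Function.update (fun j : Fin n => (j : ℕ)) k (k + 1)) = wr' fun i j => Y i j x := by
    rcases n with _ | r
    · simp [wr']
    · rw [wr'_eq, Fin.sum_univ_castSucc, Finset.sum_eq_zero, zero_add, Fin.val_last]
      exact fun i _ => colDet_update_castSucc _ i
  rw [e] at h
  exact h

theorem hasDerivAt_wr' {n : ℕ} (Y : Fin n → ℕ → ℝ → ℝ) (x : ℝ)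
    (hY : ∀ i j, HasDerivAt (Y i j) (Y i (j + 1) x) x) :
    HasDerivAt (fun x => wr' fun i j => Y i j x) (wr'' fun i j => Y i j x) x := by
  unfold wr' wr''
  refine HasDerivAt.fun_sum fun k _ => ?_
  split_ifs
  · exact hasDerivAt_colDet Y x hY _
  · exact hasDerivAt_const _ _

/-- Either both sides have a repeated column, or `i + 1 = r` and they differ by swapping the last
two columns. -/
theorem colDet_update_update (Y : Fin (r + 1) → ℕ → ℝ) (i : Fin r) :
    colDet Y (Function.update (Function.update (fun j : Fin (r + 1) => (j : ℕ))
        (Fin.last r) (r + 1)) i.castSucc (i + 1)) =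
      -colDet Y (Function.update (fun j : Fin (r + 1) => (j : ℕ)) i.castSucc (i + 2)) := by
  have hl : i.castSucc ≠ Fin.last r := (Fin.castSucc_lt_last i).ne
  have hs : i.succ ≠ i.castSucc := (Fin.castSucc_lt_succ).ne'
  by_cases hi : (i : ℕ) + 1 < r
  · rw [colDet_eq_zero Y _ (a := i.castSucc) (b := i.succ) hs.symm, colDet_eq_zero Y
      (Function.update (fun j : Fin (r + 1) => (j : ℕ)) i.castSucc (i + 2))
      (a := i.castSucc) (b := ⟨i + 2, by omega⟩), neg_zero]
    · simp [Fin.ext_iff]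
    · rw [Function.update_self, Function.update_of_ne (by simp [Fin.ext_iff])]
    · rw [Function.update_self, Function.update_of_ne hs,
        Function.update_of_ne (by simp [Fin.ext_iff]; omega)]
      simp
  · rw [← colDet_swap Y _ hl]
    congr 1
    funext j
    have hir : (i : ℕ) + 1 = r := by omega
    simp only [Function.comp_apply]
    by_cases h1 : j = i.castSucc
    · subst h1
      rw [Equiv.swap_apply_left, Function.update_self, Function.update_of_ne hl.symm]
      simp [hir]
    · by_cases h2 : j = Fin.last r
      · subst h2
        rw [Equiv.swap_apply_right, Function.update_self, Function.update_of_ne hl.symm,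
          Function.update_self]
        omega
      · rw [Equiv.swap_apply_of_ne_of_ne h1 h2, Function.update_of_ne h1, Function.update_of_ne h2,
          Function.update_of_ne h1]

/-- The same two quantities as in `wr''_eq`, with the opposite relative sign; `wr_plucker` makes up
the difference. -/
theorem sum_colDet_update_add_two (Y : Fin (r + 1) → ℕ → ℝ) :
    ∑ k : Fin (r + 1), colDet Y (Function.update (fun j : Fin (r + 1) => (j : ℕ)) k (k + 2)) =
      colDet Y (Function.update (fun j : Fin (r + 1) => (j : ℕ)) (Fin.last r) (r + 2)) -
      ∑ i : Fin r, colDet Y (Function.update (Function.update (fun j : Fin (r + 1) => (j : ℕ))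
        (Fin.last r) (r + 1)) i.castSucc (i + 1)) := by
  rw [Fin.sum_univ_castSucc]
  simp only [colDet_update_update, Finset.sum_neg_distrib, Fin.val_castSucc, Fin.val_last]
  ring

/-- The trace identity `sum_det_updateCol_mul`, with each `l i * Y i k` rewritten by the
differential equation. Raising a column by one survives only in the last column. -/
theorem wr_eigen (Y : Fin (r + 1) → ℕ → ℝ) (l : Fin (r + 1) → ℝ) (p p' q : ℝ) (g : ℕ → ℝ)
    (hY : ∀ i j, p * Y i (j + 2) + (j * p' + q) * Y i (j + 1) + (g j + l i) * Y i j = 0) :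
    p * ∑ k : Fin (r + 1),
        colDet Y (Function.update (fun j : Fin (r + 1) => (j : ℕ)) k (k + 2)) +
      (r * p' + q) * wr' Y + (∑ k ∈ Finset.range (r + 1), g k + ∑ i, l i) * wr Y = 0 := by
  have h := sum_det_updateCol_mul l (Matrix.of fun i j : Fin (r + 1) => Y i j)
  have hk : ∀ k : Fin (r + 1), ((Matrix.of fun i j : Fin (r + 1) => Y i j).updateCol k
      fun i => l i * Y i k).det =
      -(p * colDet Y (Function.update (fun j : Fin (r + 1) => (j : ℕ)) k (k + 2)) +
        (k * p' + q) * colDet Y (Function.update (fun j : Fin (r + 1) => (j : ℕ)) k (k + 1)) +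
        g k * wr Y) := by
    intro k
    have e : (fun i => l i * Y i k) = (-p) • (fun i => Y i (k + 2)) +
        ((-(k * p' + q)) • (fun i => Y i (k + 1)) + (-g k) • (fun i => Y i k)) := by
      funext i
      simp only [Pi.add_apply, Pi.smul_apply, smul_eq_mul]
      linear_combination hY i k
    have e2 : (Matrix.of fun i j : Fin (r + 1) => Y i j).updateCol k (fun i => Y i k) =
        Matrix.of fun i j : Fin (r + 1) => Y i j :=
      Matrix.updateCol_eq_self _ _
    rw [e, Matrix.det_updateCol_add, Matrix.det_updateCol_add, Matrix.det_updateCol_smul,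
      Matrix.det_updateCol_smul, Matrix.det_updateCol_smul, colDet_update, colDet_update, e2,
      wr, colDet]
    ring
  simp only [Matrix.of_apply, hk, Finset.sum_neg_distrib, Finset.sum_add_distrib] at h
  have h1 : ∑ k : Fin (r + 1), ((k : ℕ) * p' + q) *
      colDet Y (Function.update (fun j : Fin (r + 1) => (j : ℕ)) k (k + 1)) =
      (r * p' + q) * wr' Y := by
    rw [Fin.sum_univ_castSucc, Finset.sum_eq_zero, zero_add, Fin.val_last, wr'_eq]
    intro i _
    rw [Fin.val_castSucc, colDet_update_castSucc, mul_zero]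
  rw [h1, ← Finset.mul_sum, ← Finset.sum_mul, Fin.sum_univ_eq_sum_range g] at h
  change _ = _ * wr Y at h
  linear_combination -h

/-- A three-term Plücker relation. -/
theorem wr_plucker (Y : Fin (r + 2) → ℕ → ℝ) (Z : Fin (r + 1) → ℕ → ℝ)
    (hZ : ∀ i, Z i = Y i.succ) :
    colDet Y (Function.update (Function.update (fun j : Fin (r + 2) => (j : ℕ))
        (Fin.last (r + 1)) (r + 2)) (Fin.last r).castSucc (r + 1)) * wr Z -
      wr' Y * wr' Z + wr Y *
        colDet Z (Function.update (fun j : Fin (r + 1) => (j : ℕ)) (Fin.last r) (r + 2)) = 0 := by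
  set M := Matrix.of fun i j : Fin (r + 2) => Y i j with hM
  set N := Matrix.of fun i j : Fin (r + 1) => Z i j with hN
  set φ : (Fin (r + 2) → ℝ) → ℝ := fun v => Matrix.cramer N (fun i => v i.succ) (Fin.last r)
    with hφ
  -- Cramer's rule expands column `r + 2` in columns `0, …, r + 1` of `Y`. The functional `φ` drops
  -- row `0` and puts the result in the last column of `N`, which kills all columns but `r` and `r +
  -- 1`.
  have hcr := Matrix.mulVec_cramer M fun i => Y i (r + 2)
  have h1 := congrArg φ hcr
  have hφN : ∀ l : ℕ, φ (fun i => Y i l) =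
      colDet Z (Function.update (fun j : Fin (r + 1) => (j : ℕ)) (Fin.last r) l) := by
    intro l
    rw [colDet_update]
    simp only [hφ, Matrix.cramer_apply, hZ, hN]
  have hR : φ (M.det • fun i => Y i (r + 2)) = M.det * φ (fun i => Y i (r + 2)) := by
    simp only [hφ]
    rw [← smul_eq_mul, ← Pi.smul_apply, ← map_smul]
    rfl
  have hL : φ (M.mulVec (Matrix.cramer M fun i => Y i (r + 2))) =
      ∑ j : Fin (r + 2), φ (fun i => Y i j) * Matrix.cramer M (fun i => Y i (r + 2)) j := by
    have e : (fun i : Fin (r + 1) =>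
        M.mulVec (Matrix.cramer M fun i => Y i (r + 2)) i.succ) =
        ∑ j : Fin (r + 2), Matrix.cramer M (fun i => Y i (r + 2)) j •
          (fun i : Fin (r + 1) => Y i.succ j) := by
      funext i
      rw [Finset.sum_apply]
      simp only [Matrix.mulVec, dotProduct, Pi.smul_apply, smul_eq_mul, hM, Matrix.of_apply]
      exact Finset.sum_congr rfl fun j _ => mul_comm _ _
    simp only [hφ]
    rw [e, map_sum, Finset.sum_apply]
    refine Finset.sum_congr rfl fun j _ => ?_
    rw [map_smul, Pi.smul_apply, smul_eq_mul, mul_comm]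
  rw [hR, hL, Fin.sum_univ_castSucc, Fin.sum_univ_castSucc, Finset.sum_eq_zero, zero_add] at h1
  · simp only [hφN, Matrix.cramer_apply, hM, ← colDet_update, Fin.val_last, Fin.val_castSucc] at h1
    have e1 : Function.update (fun j : Fin (r + 1) => (j : ℕ)) (Fin.last r) r =
        fun j : Fin (r + 1) => (j : ℕ) :=
      Function.update_eq_self_iff.2 rfl
    have hl : (Fin.last r).castSucc ≠ Fin.last (r + 1) := (Fin.castSucc_lt_last _).ne
    have e2 : colDet Y (Function.update (Function.update (fun j : Fin (r + 2) => (j : ℕ))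
        (Fin.last (r + 1)) (r + 2)) (Fin.last r).castSucc (r + 1)) =
        -colDet Y (Function.update (fun j : Fin (r + 2) => (j : ℕ)) (Fin.last r).castSucc (r + 2)) :=
      colDet_update_update Y (Fin.last r)
    rw [e1] at h1
    rw [wr'_eq, wr'_eq, e2, wr, wr]
    change _ = colDet Y _ * _ at h1
    linear_combination -h1
  · intro i _
    rw [hφN, colDet_eq_zero Z _ (a := i.castSucc) (b := Fin.last r), zero_mul]
    · exact (Fin.castSucc_lt_last i).ne
    · rw [Function.update_self, Function.update_of_ne (Fin.castSucc_lt_last i).ne]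
      simp

/-- The bilinear form of the Darboux–Crum theorem. -/
theorem wr_bilinear {k : ℕ} (Y : Fin (k + 1) → ℕ → ℝ) (Z : Fin k → ℕ → ℝ)
    (hZ : ∀ i, Z i = Y i.succ) (l : Fin (k + 1) → ℝ) (p p' q : ℝ) (g : ℕ → ℝ) (hg : g 0 = 0)
    (hY : ∀ i j, p * Y i (j + 2) + (j * p' + q) * Y i (j + 1) + (g j + l i) * Y i j = 0) :
    p * (wr'' Y * wr Z - 2 * wr' Y * wr' Z + wr Y * wr'' Z) + (k * p' + q) * wr' Y * wr Z -
      ((k - 1) * p' + q) * wr Y * wr' Z + (g k + l 0) * wr Y * wr Z = 0 := by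
  rcases k with _ | r
  · have h := hY 0 0
    simp only [wr'', wr', wr, colDet]
    simp [hg] at h ⊢
    linear_combination h
  · have hW := wr_eigen Y l p p' q g hY
    have hV := wr_eigen Z (fun i => l i.succ) p p' q g fun i j => by rw [hZ]; exact hY _ _
    have hP := wr_plucker Y Z hZ
    rw [sum_colDet_update_add_two] at hW hV
    have h3 : ∑ i : Fin (r + 1), colDet Y (Function.update (Function.update
        (fun j : Fin (r + 1 + 1) => (j : ℕ)) (Fin.last (r + 1)) (r + 1 + 1)) i.castSucc (i + 1)) =
        colDet Y (Function.update (Function.update (fun j : Fin (r + 2) => (j : ℕ))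
        (Fin.last (r + 1)) (r + 2)) (Fin.last r).castSucc (r + 1)) := by
      rw [Fin.sum_univ_castSucc, Finset.sum_eq_zero, zero_add, Fin.val_last]
      intro i _
      rw [colDet_update_update, Fin.val_castSucc, neg_eq_zero]
      refine colDet_eq_zero Y _ (a := i.castSucc.castSucc) (b := i.succ.succ) ?_ ?_
      · simp [Fin.ext_iff]
        omega
      · rw [Function.update_self, Function.update_of_ne (by simp [Fin.ext_iff]; omega)]
        simp
    rw [wr''_eq Y, wr''_eq Z, h3]
    rw [h3] at hW
    rw [Finset.sum_range_succ _ (r + 1), Fin.sum_univ_succ l] at hW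
    push_cast at hW hV ⊢
    -- In the difference the sums of `l` and `g` cancel except for `l 0` and `g (r + 1)`.
    linear_combination wr Z * hW - wr Y * hV + 2 * p * hP

end Wronskian

/-! ### The two families of eigenfunctions on `x > -1`. -/

section Eigenfunctions

/-- The `j`-th derivative of `(1+x)^{-s} q`, for `x > -1`. -/
def weightedDeriv (s : ℝ) (q : ℝ[X]) (j : ℕ) (x : ℝ) : ℝ :=
  (1 + x) ^ (-s - j) * ((-1) ^ j * (twistedDeriv s j q).eval x)

theorem hasDerivAt_one_add_rpow (a : ℝ) {x : ℝ} (hx : -1 < x) :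
    HasDerivAt (fun x : ℝ => (1 + x) ^ a) (a * (1 + x) ^ (a - 1)) x := by
  have h := ((hasDerivAt_id x).const_add 1).rpow_const (p := a) (Or.inl (by simp; linarith))
  simpa using h

theorem hasDerivAt_weightedDeriv (s : ℝ) (q : ℝ[X]) (j : ℕ) {x : ℝ} (hx : -1 < x) :
    HasDerivAt (weightedDeriv s q j) (weightedDeriv s q (j + 1) x) x := by
  have ht : 0 < 1 + x := by linarith
  have h := (hasDerivAt_one_add_rpow (-s - j) hx).mul
    (((twistedDeriv s j q).hasDerivAt x).const_mul ((-1) ^ j))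
  convert! h using 1
  rw [weightedDeriv, twistedDeriv]
  have e : (1 + x) ^ (-s - (j : ℝ)) = (1 + x) ^ (-s - ((j + 1 : ℕ) : ℝ)) * (1 + x) := by
    rw [← Real.rpow_add_one ht.ne']
    congr 1
    push_cast
    ring
  have e2 : -s - (j : ℝ) - 1 = -s - ((j + 1 : ℕ) : ℝ) := by
    push_cast
    ring
  rw [e2, e]
  simp only [eval_sub, eval_mul, eval_add, eval_C, eval_one, eval_X, eval_natCast, C_add, C_eq_natCast]
  ring

/-- Conjugating by `(1+x)^{-s}` leaves an obstruction proportional to `s(s-β)`; the roots `s = 0`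
and `s = β` give the local exponents at `x = -1` and the two types of rows. -/
theorem weightedDeriv_ode (α β s : ℝ) (hs : s * (s - β) = 0) (n : ℕ) {x : ℝ} (hx : -1 < x) :
    (1 - x ^ 2) * weightedDeriv s (jacobi α (β - 2 * s) n) 2 x +
      (β - α - (α + β + 2) * x) * weightedDeriv s (jacobi α (β - 2 * s) n) 1 x +
      lam α β (n - s) * weightedDeriv s (jacobi α (β - 2 * s) n) 0 x = 0 := by
  have ht : 0 < 1 + x := by linarith
  have e1 : (1 + x) ^ (-s - ((1 : ℕ) : ℝ)) = (1 + x) ^ (-s - ((2 : ℕ) : ℝ)) * (1 + x) := by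
    rw [← Real.rpow_add_one ht.ne']
    congr 1
    push_cast
    ring
  have e0 : (1 + x) ^ (-s - ((0 : ℕ) : ℝ)) = (1 + x) ^ (-s - ((2 : ℕ) : ℝ)) * (1 + x) * (1 + x) := by
    rw [← e1, ← Real.rpow_add_one ht.ne']
    congr 1
    push_cast
    ring
  have ho := congrArg (eval x) (jacobi_ode α (β - 2 * s) n)
  simp only [eval_sub, eval_mul, eval_add, eval_C, eval_one, eval_X, eval_pow, eval_zero] at ho
  simp only [weightedDeriv]
  rw [e0, e1]
  simp only [twistedDeriv, eval_sub, eval_mul, eval_add, eval_C, eval_one,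
    eval_X, derivative_mul, derivative_add, derivative_sub, derivative_C, derivative_one,
    derivative_X, lam, Nat.cast_zero, Nat.cast_one, eval_zero]
  linear_combination (1 + x) ^ (-s - ((2 : ℕ) : ℝ)) * ((1 + x) ^ 2 * ho +
    2 * (1 + x) * (jacobi α (β - 2 * s) n).eval x * hs)

theorem eq_zero_of_hasDerivAt {f : ℝ → ℝ} {f' x : ℝ} (hf : ∀ y, -1 < y → f y = 0) (hx : -1 < x)
    (h : HasDerivAt f f' x) : f' = 0 := by
  refine h.unique ((hasDerivAt_const x (0 : ℝ)).congr_of_eventuallyEq ?_)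
  filter_upwards [lt_mem_nhds hx] with y hy using hf y hy

/-- Differentiating the equation `j` times changes its coefficients in a way independent of the
eigenvalue `l`, the form `wr_bilinear` needs. -/
theorem ode_iterate (Y : ℕ → ℝ → ℝ) (c₀ c₁ l : ℝ)
    (hY : ∀ j x, -1 < x → HasDerivAt (Y j) (Y (j + 1) x) x)
    (h0 : ∀ x, -1 < x → (1 - x ^ 2) * Y 2 x + (c₀ - c₁ * x) * Y 1 x + l * Y 0 x = 0) (j : ℕ) :
    ∀ x, -1 < x → (1 - x ^ 2) * Y (j + 2) x + (j * (-2 * x) + (c₀ - c₁ * x)) * Y (j + 1) x +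
      (-(j * (j - 1) + j * c₁) + l) * Y j x = 0 := by
  induction j with
  | zero => simpa using h0
  | succ j ih =>
    intro x hx
    refine eq_zero_of_hasDerivAt ih hx ?_
    have hp : HasDerivAt (fun x : ℝ => 1 - x ^ 2) (-2 * x) x := by
      have := ((hasDerivAt_id x).pow 2).const_sub 1
      simpa using this
    have hq : HasDerivAt (fun x : ℝ => (j : ℝ) * (-2 * x) + (c₀ - c₁ * x)) (j * (-2) - c₁) x := by
      have := (((hasDerivAt_id x).const_mul (-2)).const_mul (j : ℝ)).add
        (((hasDerivAt_id x).const_mul c₁).const_sub c₀)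
      convert! this using 1
      ring
    have h := ((hp.mul (hY (j + 2) x hx)).add (hq.mul (hY (j + 1) x hx))).add
      ((hY j x hx).const_mul (-((j : ℝ) * (j - 1) + j * c₁) + l))
    convert! h using 1
    push_cast
    ring

end Eigenfunctions

/-! ### From Wronskians back to polynomials. -/

section Typed

/-- The seed polynomials of a determinant with rows of types `τ` and degrees `N`. -/
def seed (α β : ℝ) {m : ℕ} (τ : Fin m → Bool) (N : Fin m → ℕ) (i : Fin m) : ℝ[X] :=
  jacobi α (β - 2 * twist β (τ i)) (N i)

/-- With `a = m - b`, the exponent is `(m-1)a + b(b-1)` from the polynomial side minus `m(m-1) + bβ`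
cleared from the rows. The constant `ε` collects the signs of the columns. -/
theorem exists_wr_eq {m : ℕ} (β : ℝ) (τ : Fin m → Bool) (q : Fin m → ℝ[X]) (b : ℕ)
    (hb : (Finset.univ.filter fun i => ¬ τ i = false).card = b) (G : ℝ[X])
    (hG : typedDet β τ q = (1 + X) ^ (b * (b - 1)) * G) :
    ∃ ε : ℝ, ε ≠ 0 ∧ ∀ x, -1 < x →
      wr (fun i j => weightedDeriv (twist β (τ i)) (q i) j x) =
        ε * (1 + x) ^ ((b : ℝ) * (b - m - β)) * G.eval x := by
  refine ⟨∏ j : Fin m, (-1) ^ (j : ℕ), Finset.prod_ne_zero_iff.2 fun j _ => by simp, ?_⟩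
  intro x hx
  have ht : 0 < 1 + x := by linarith
  set a := (Finset.univ.filter fun i => τ i = false).card with ha
  have hab : (a : ℝ) + b = m := by
    rw [← hb, ha, ← Nat.cast_add, Finset.card_filter_add_card_filter_not]
    simp
  have h1 := congrArg (eval x) (twistedWronskian_twist β τ q)
  rw [← ha, hG] at h1
  simp only [eval_mul, eval_pow, eval_add, eval_one, eval_X] at h1
  have h2 : (twistedWronskian (fun i => twist β (τ i)) q).eval x =
      (∏ i, (1 + x) ^ ((m : ℝ) - 1 + twist β (τ i))) * ((∏ j : Fin m, (-1) ^ (j : ℕ)) *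
        wr (fun i j => weightedDeriv (twist β (τ i)) (q i) j x)) := by
    rw [wr, colDet, ← Matrix.det_mul_row, ← Matrix.det_mul_column, twistedWronskian,
      ← coe_evalRingHom, RingHom.map_det]
    congr 1
    ext i j
    simp only [RingHom.mapMatrix_apply, Matrix.map_apply, Matrix.of_apply, coe_evalRingHom,
      eval_mul, eval_pow, eval_add, eval_one, eval_X, weightedDeriv]
    have hj := j.isLt
    have e : (1 + x) ^ (m - 1 - (j : ℕ)) =
        (1 + x) ^ ((m : ℝ) - 1 + twist β (τ i)) * (1 + x) ^ (-twist β (τ i) - (j : ℕ)) := by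
      rw [← Real.rpow_add ht, ← Real.rpow_natCast, Nat.cast_sub (show (j : ℕ) ≤ m - 1 by omega),
        Nat.cast_sub (show 1 ≤ m by omega)]
      congr 1
      push_cast
      ring
    have e2 : ((-1 : ℝ) ^ (j : ℕ)) * (-1) ^ (j : ℕ) = 1 := by
      rw [← mul_pow]; simp
    rw [e]
    linear_combination (-(1 + x) ^ ((m : ℝ) - 1 + twist β (τ i)) *
      (1 + x) ^ (-twist β (τ i) - (j : ℕ)) * (twistedDeriv (twist β (τ i)) j (q i)).eval x) * e2
  have h3 : ∏ i, (1 + x) ^ ((m : ℝ) - 1 + twist β (τ i)) = (1 + x) ^ ((m : ℝ) * (m - 1) + b * β) := by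
    rw [← Real.rpow_sum_of_pos ht]
    congr 1
    rw [Finset.sum_add_distrib]
    have : ∀ i, twist β (τ i) = if ¬ τ i = false then β else 0 := by
      intro i
      cases τ i <;> simp [twist]
    simp only [this]
    rw [← Finset.sum_filter, Finset.sum_const, Finset.sum_const, hb]
    simp
  have h4 : (1 + x) ^ ((m - 1) * a) * (1 + x) ^ (b * (b - 1)) =
      (1 + x) ^ ((m : ℝ) * (m - 1) + b * β) * (1 + x) ^ ((b : ℝ) * (b - m - β)) := by
    rw [← Real.rpow_add ht, ← pow_add, ← Real.rpow_natCast]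
    congr 1
    have hz : ((b * (b - 1) : ℕ) : ℝ) = b * (b - 1) := by
      rcases b with _ | b <;> simp
    have hm : (((m - 1) * a : ℕ) : ℝ) = (m - 1) * a := by
      rcases m with _ | m
      · have : (a : ℝ) = 0 := by
          have h0 : (0 : ℝ) ≤ b := b.cast_nonneg
          have h0' : (0 : ℝ) ≤ a := a.cast_nonneg
          push_cast at hab
          linarith
        simp [this]
      · simp
    rw [Nat.cast_add, hz, hm, ← hab]
    ring
  have h5 : (∏ j : Fin m, (-1 : ℝ) ^ (j : ℕ)) * ∏ j : Fin m, (-1 : ℝ) ^ (j : ℕ) = 1 := by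
    rw [← Finset.prod_mul_distrib]
    refine Finset.prod_eq_one fun j _ => ?_
    rw [← mul_pow]; simp
  rw [h2, h3, ← mul_assoc ((1 + x) ^ ((m - 1) * a)), h4] at h1
  have hne : (1 + x) ^ ((m : ℝ) * (m - 1) + b * β) ≠ 0 := (Real.rpow_pos_of_pos ht _).ne'
  rw [mul_assoc] at h1
  have h6 := mul_left_cancel₀ hne h1
  linear_combination (∏ j : Fin m, (-1 : ℝ) ^ (j : ℕ)) * h6 -
    wr (fun i j => weightedDeriv (twist β (τ i)) (q i) j x) * h5

theorem derivs_of_eq_rpow_mul {f f₁ f₂ : ℝ → ℝ} (ε A : ℝ) (G : ℝ[X])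
    (hf : ∀ x, -1 < x → f x = ε * (1 + x) ^ A * G.eval x)
    (h1 : ∀ x, -1 < x → HasDerivAt f (f₁ x) x) (h2 : ∀ x, -1 < x → HasDerivAt f₁ (f₂ x) x)
    {x : ℝ} (hx : -1 < x) :
    f x = ε * (1 + x) ^ (A - 2) * ((1 + x) ^ 2 * G.eval x) ∧
    f₁ x = ε * (1 + x) ^ (A - 2) *
      ((1 + x) * (A * G.eval x + (1 + x) * (derivative G).eval x)) ∧
    f₂ x = ε * (1 + x) ^ (A - 2) * (A * (A - 1) * G.eval x +
      2 * A * (1 + x) * (derivative G).eval x +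
        (1 + x) ^ 2 * (derivative (derivative G)).eval x) := by
  have step : ∀ {f f₁ : ℝ → ℝ} (A : ℝ) (G : ℝ[X]),
      (∀ x, -1 < x → f x = ε * (1 + x) ^ A * G.eval x) →
      (∀ x, -1 < x → HasDerivAt f (f₁ x) x) → ∀ x, -1 < x →
      f₁ x = ε * (1 + x) ^ (A - 1) * (C A * G + (1 + X) * derivative G).eval x := by
    intro f f₁ A G hf h x hx
    have ht : 0 < 1 + x := by linarith
    have hd := ((hasDerivAt_one_add_rpow A hx).const_mul ε).mul (G.hasDerivAt x)
    have := (h x hx).unique (hd.congr_of_eventuallyEq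
      (by filter_upwards [lt_mem_nhds hx] with y hy using hf y hy))
    rw [this]
    have e : (1 + x) ^ A = (1 + x) ^ (A - 1) * (1 + x) := by
      rw [← Real.rpow_add_one ht.ne', sub_add_cancel]
    rw [e]
    simp only [eval_add, eval_mul, eval_C, eval_one, eval_X]
    ring
  have ht : 0 < 1 + x := by linarith
  have hs1 := step A G hf h1
  have hs2 := step (A - 1) _ hs1 h2
  have e1 : (1 + x) ^ (A - 1) = (1 + x) ^ (A - 2) * (1 + x) := by
    rw [← Real.rpow_add_one ht.ne']
    congr 1
    ring
  have e0 : (1 + x) ^ A = (1 + x) ^ (A - 2) * (1 + x) ^ 2 := by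
    rw [← Real.rpow_natCast, ← Real.rpow_add ht]
    congr 1
    push_cast
    ring
  refine ⟨?_, ?_, ?_⟩
  · rw [hf x hx, e0]
    ring
  · rw [hs1 x hx, e1]
    simp only [eval_add, eval_mul, eval_C, eval_one, eval_X]
    ring
  · rw [hs2 x hx, sub_sub, one_add_one_eq_two]
    simp only [eval_add, eval_mul, eval_C, eval_one, eval_X, derivative_add, derivative_mul,
      derivative_C, derivative_one, derivative_X, eval_zero]
    ring

theorem typed_bilinear (α β : ℝ) {k : ℕ} (τ : Fin k → Bool) (N : Fin k → ℕ) (n a b : ℕ)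
    (hab : a + b = k) (hb : (Finset.univ.filter fun i => ¬ τ i = false).card = b)
    (hb' : (Finset.univ.filter fun i => ¬ (Fin.cons false τ : Fin (k + 1) → Bool) i = false).card = b)
    (V W : ℝ[X]) (hV : typedDet β τ (seed α β τ N) = (1 + X) ^ (b * (b - 1)) * V)
    (hW : typedDet β (Fin.cons false τ) (seed α β (Fin.cons false τ) (Fin.cons n N)) =
      (1 + X) ^ (b * (b - 1)) * W) (x : ℝ) :
    (1 - x ^ 2) * ((derivative (derivative W)).eval x * V.eval x -
        2 * (derivative W).eval x * (derivative V).eval x +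
        W.eval x * (derivative (derivative V)).eval x) +
      (β - α - 2 * b - (α + β + 2 * a + 2) * x) * (derivative W).eval x * V.eval x +
      (α - β + 2 * b + (2 * a + α + β) * x) * W.eval x * (derivative V).eval x +
      (lam α β n - lam α β a) * W.eval x * V.eval x = 0 := by
  have key : ∀ x, -1 < x →
      ((1 - X ^ 2) * (derivative (derivative W) * V - 2 * derivative W * derivative V +
        W * derivative (derivative V)) +
      (C (β - α - 2 * b) - C (α + β + 2 * a + 2) * X) * derivative W * V +
      (C (α - β + 2 * b) + C (2 * a + α + β) * X) * W * derivative V +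
      C (lam α β n - lam α β a) * W * V : ℝ[X]).eval x = 0 := by
    intro x hx
    have ht : 0 < 1 + x := by linarith
    obtain ⟨ε, hε, hwV⟩ := exists_wr_eq β τ _ b hb V hV
    obtain ⟨ε', hε', hwW⟩ := exists_wr_eq β _ _ b hb' W hW
    set τ' : Fin (k + 1) → Bool := Fin.cons false τ with hτ'
    set N' : Fin (k + 1) → ℕ := Fin.cons n N with hN'
    have hdV : ∀ y, -1 < y → ∀ i j, HasDerivAt (weightedDeriv (twist β (τ i)) (seed α β τ N i) j)
        (weightedDeriv (twist β (τ i)) (seed α β τ N i) (j + 1) y) y :=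
      fun y hy i j => hasDerivAt_weightedDeriv _ _ _ hy
    have hdW : ∀ y, -1 < y → ∀ i j,
        HasDerivAt (weightedDeriv (twist β (τ' i)) (seed α β τ' N' i) j)
        (weightedDeriv (twist β (τ' i)) (seed α β τ' N' i) (j + 1) y) y :=
      fun y hy i j => hasDerivAt_weightedDeriv _ _ _ hy
    obtain ⟨v0, v1, v2⟩ := derivs_of_eq_rpow_mul ε _ V hwV
      (fun y hy => hasDerivAt_wr _ y (hdV y hy)) (fun y hy => hasDerivAt_wr' _ y (hdV y hy)) hx
    obtain ⟨w0, w1, w2⟩ := derivs_of_eq_rpow_mul ε' _ W hwW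
      (fun y hy => hasDerivAt_wr _ y (hdW y hy)) (fun y hy => hasDerivAt_wr' _ y (hdW y hy)) hx
    have hbil := wr_bilinear
      (fun i j => weightedDeriv (twist β (τ' i)) (seed α β τ' N' i) j x)
      (fun i j => weightedDeriv (twist β (τ i)) (seed α β τ N i) j x)
      (fun i => by simp [hτ', hN', seed]) (fun i => lam α β (N' i - twist β (τ' i)))
      (1 - x ^ 2) (-2 * x) (β - α - (α + β + 2) * x)
      (fun j => -((j : ℝ) * (j - 1) + j * (α + β + 2))) (by simp)
      (fun i j => ode_iterate _ _ _ _ (fun j y hy => hasDerivAt_weightedDeriv _ _ j hy)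
        (fun y hy => weightedDeriv_ode α β _ (by cases τ' i <;> simp [twist]) _ hy) j x hx)
    rw [v0, v1, v2, w0, w1, w2] at hbil
    have hl : lam α β ((N' 0 : ℕ) - twist β (τ' 0)) = lam α β n := by
      simp [hτ', hN', twist]
    simp only [hl] at hbil
    -- The exponents of the two Wronskians differ by `b`; after substitution all terms share this
    -- nonzero factor.
    have hfac : ε * (1 + x) ^ ((b : ℝ) * (b - k - β) - 2) *
        (ε' * (1 + x) ^ ((b : ℝ) * (b - (k + 1 : ℕ) - β) - 2)) * (1 + x) ^ 4 ≠ 0 := by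
      have := Real.rpow_pos_of_pos ht ((b : ℝ) * (b - k - β) - 2)
      have := Real.rpow_pos_of_pos ht ((b : ℝ) * (b - (k + 1 : ℕ) - β) - 2)
      positivity
    refine (mul_eq_zero.1 ?_).resolve_left hfac
    simp only [eval_sub, eval_mul, eval_add, eval_C, eval_one, eval_X, eval_pow, eval_ofNat, lam]
      at hbil ⊢
    have hk : (k : ℝ) = a + b := by rw [← hab]; push_cast; ring
    generalize (1 + x) ^ ((b : ℝ) * (b - k - β) - 2) = R at hbil ⊢
    generalize (1 + x) ^ ((b : ℝ) * (b - (k + 1 : ℕ) - β) - 2) = R' at hbil ⊢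
    push_cast at hbil
    rw [hk] at hbil
    linear_combination hbil
  -- A polynomial vanishing on `(-1, ∞)` is zero, so the identity extends to all real `x`.
  have h0 := eq_zero_of_infinite_isRoot _ ((Set.Ioi_infinite (-1 : ℝ)).mono key)
  have h1 := congrArg (eval x) h0
  simpa only [eval_sub, eval_mul, eval_add, eval_C, eval_one, eval_X, eval_pow, eval_ofNat,
    eval_zero] using h1

end Typed

/-! ### The matrices of the theorem as typed determinants. -/

section Main

variable (α β : ℝ) (F₁ F₂ : Finset ℕ)

/-- The types of the rows indexed by `F₁` and `F₂`. -/
def rowType : Fin (F₁.card + F₂.card) → Bool := Fin.append (fun _ => false) (fun _ => true)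

/-- The degrees of the rows indexed by `F₁` and `F₂`. -/
def rowDegree : Fin (F₁.card + F₂.card) → ℕ :=
  Fin.append (fun i => F₁.orderEmbOfFin rfl i) (fun i => F₂.orderEmbOfFin rfl i)

theorem rowI_eq (m f : ℕ) :
    rowI α β m f = typedRow β m false (jacobi α (β - 2 * twist β false) f) := by
  funext j
  simp [rowI, typedRow, twist]

theorem rowII_eq (m f : ℕ) :
    rowII α β m f = typedRow β m true (jacobi α (β - 2 * twist β true) f) := by
  funext j
  simp only [rowII, typedRow, twist, if_true]
  rw [show β - 2 * β = -β by ring, twistedDeriv_jacobi]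
  ring

theorem rows_eq (m : ℕ) (i : Fin (F₁.card + F₂.card)) :
    rows α β F₁ F₂ m i =
      typedRow β m (rowType F₁ F₂ i) (seed α β (rowType F₁ F₂) (rowDegree F₁ F₂) i) := by
  refine Fin.addCases (fun i => ?_) (fun i => ?_) i
  · simp [rows, seed, rowType, rowDegree, rowI_eq]
  · simp [rows, seed, rowType, rowDegree, rowII_eq]

theorem OmegaNum_eq : OmegaNum α β F₁ F₂ =
    typedDet β (rowType F₁ F₂) (seed α β (rowType F₁ F₂) (rowDegree F₁ F₂)) := by
  rw [OmegaNum, typedDet]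
  congr 1
  ext1 i j
  rw [Matrix.of_apply, rows_eq, Matrix.of_apply]

theorem PNum_eq (n : ℕ) : PNum α β F₁ F₂ n =
    typedDet β (Fin.cons false (rowType F₁ F₂))
      (seed α β (Fin.cons false (rowType F₁ F₂))
        (Fin.cons (n - u F₁ F₂) (rowDegree F₁ F₂))) := by
  rw [PNum, typedDet]
  congr 1
  ext1 i j
  rw [Matrix.of_apply, Matrix.of_apply]
  refine Fin.cases ?_ (fun i => ?_) i
  · simp [seed, rowI_eq]
  · simp [seed, rows_eq]

theorem card_rowType :
    (Finset.univ.filter fun i => ¬ rowType F₁ F₂ i = false).card = F₂.card := by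
  rw [Finset.card_filter, Fin.sum_univ_add]
  simp only [rowType, Fin.append_left, Fin.append_right]
  simp

theorem card_cons_rowType :
    (Finset.univ.filter fun i =>
      ¬ (Fin.cons false (rowType F₁ F₂) : Fin (F₁.card + F₂.card + 1) → Bool) i = false).card =
      F₂.card := by
  refine Eq.trans ?_ (card_rowType F₁ F₂)
  rw [Finset.card_filter, Finset.card_filter, Fin.sum_univ_succ]
  simp only [Fin.cons_zero, Fin.cons_succ, not_true_eq_false, if_false, zero_add]

variable {α β F₁ F₂}

/-- Nodes of one type are distinct since degrees are; a collision between the types would read `β -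
f = -n`. -/
theorem twist_sub_rowDegree_injective (hβ : ∀ f ∈ F₂, ∀ n : ℕ, β ≠ f - n) :
    Function.Injective fun i => twist β (rowType F₁ F₂ i) - rowDegree F₁ F₂ i := by
  intro i j
  refine Fin.addCases (fun i => ?_) (fun i => ?_) i <;>
    refine Fin.addCases (fun j => ?_) (fun j => ?_) j <;> intro h <;>
    simp only [rowType, rowDegree, Fin.append_left, Fin.append_right, twist, if_true,
      Bool.false_eq_true, if_false, zero_sub, neg_inj, sub_right_inj, Nat.cast_inj,
      EmbeddingLike.apply_eq_iff_eq] at h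
  · rw [h]
  · exact absurd (by linarith) (hβ _ (F₂.orderEmbOfFin_mem rfl j) (F₁.orderEmbOfFin rfl i))
  · exact absurd (by linarith) (hβ _ (F₂.orderEmbOfFin_mem rfl i) (F₁.orderEmbOfFin rfl j))
  · rw [h]

theorem cons_twist_sub_rowDegree_injective (hβ : ∀ f ∈ F₂, ∀ n : ℕ, β ≠ f - n) (n : ℕ)
    (hn : n ∉ F₁) :
    Function.Injective fun i : Fin (F₁.card + F₂.card + 1) =>
      twist β ((Fin.cons false (rowType F₁ F₂) : _ → Bool) i) -
        ((Fin.cons n (rowDegree F₁ F₂) : _ → ℕ) i : ℝ) := by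
  have h : (fun i : Fin (F₁.card + F₂.card + 1) =>
      twist β ((Fin.cons false (rowType F₁ F₂) : _ → Bool) i) -
        ((Fin.cons n (rowDegree F₁ F₂) : _ → ℕ) i : ℝ)) =
      Fin.cons (-(n : ℝ)) fun i => twist β (rowType F₁ F₂ i) - rowDegree F₁ F₂ i := by
    funext i
    refine Fin.cases ?_ (fun i => ?_) i <;> simp [twist]
  rw [h, Fin.cons_injective_iff]
  refine ⟨?_, twist_sub_rowDegree_injective hβ⟩
  rintro ⟨i, hi⟩
  revert hi
  refine Fin.addCases (fun i => ?_) (fun i => ?_) i <;> intro h <;>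
    simp only [rowType, rowDegree, Fin.append_left, Fin.append_right, twist, if_true,
      Bool.false_eq_true, if_false, zero_sub, neg_inj, Nat.cast_inj] at h
  · exact hn (h ▸ F₁.orderEmbOfFin_mem rfl i)
  · exact hβ _ (F₂.orderEmbOfFin_mem rfl i) n (by linarith)

/-- The conditions on `α + β` and `α - β` give the seeds of type I and II, with second parameters
`β` and `-β`, their full degree. -/
theorem typedDet_seed_ne_zero {m : ℕ} (τ : Fin m → Bool) (N : Fin m → ℕ)
    (hαβ : ∀ k : ℕ, 1 ≤ k → α + β ≠ -(k : ℝ))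
    (hτ : ∀ i, τ i = true → ∀ k : ℕ, 1 ≤ k → α - β ≠ -(k : ℝ))
    (hinj : Function.Injective fun i => twist β (τ i) - (N i : ℝ)) :
    typedDet β τ (seed α β τ N) ≠ 0 := by
  have h : ∀ i, ∀ k : ℕ, 1 ≤ k → α + (β - 2 * twist β (τ i)) ≠ -(k : ℝ) := by
    intro i k hk
    cases hi : τ i
    · simpa [twist] using hαβ k hk
    · have := hτ i hi k hk
      simp only [twist, if_true]
      rwa [show α + (β - 2 * β) = α - β by ring]
  refine typedDet_ne_zero β τ _ (fun i => jacobi_ne_zero _ _ _ (h i)) ?_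
  simp only [seed, natDegree_jacobi _ _ _ (h _)]
  exact hinj

end Main

end ExceptionalJacobi

end

theorem theorem5p1 (α β : ℝ) (F₁ F₂ : Finset ℕ)
    (hF₁ : ∀ f ∈ F₁, 0 < f) (hF₂ : ∀ f ∈ F₂, 0 < f)
    (hα : ∀ m : ℕ, 1 ≤ m → α ≠ -(m : ℝ))
    (hβ : ∀ m : ℕ, 1 ≤ m → β ≠ -(m : ℝ))
    (hαβ : ∀ m : ℕ, 1 ≤ m → α + β ≠ -(m : ℝ))
    (hpar : ∀ h : F₂.Nonempty, ∀ m : ℕ, 1 ≤ m →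
      α - β ≠ -(m : ℝ) ∧ β - (F₂.max' h : ℝ) - 1 ≠ -(m : ℝ)) :
    -- the quotients defining `Ω_F` and `P_n^F` are exact, and `Ω_F` is not the zero polynomial
    ExceptionalJacobi.denom F₂ ∣ ExceptionalJacobi.OmegaNum α β F₁ F₂ ∧
    ExceptionalJacobi.Omega α β F₁ F₂ ≠ 0 ∧
    ∀ n ∈ ExceptionalJacobi.sigma F₁ F₂,
      ExceptionalJacobi.denom F₂ ∣ ExceptionalJacobi.PNum α β F₁ F₂ n ∧
      ExceptionalJacobi.P α β F₁ F₂ n ≠ 0 ∧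
      ∀ x : ℝ, (ExceptionalJacobi.Omega α β F₁ F₂).eval x ≠ 0 →
        ExceptionalJacobi.D α β F₁ F₂
            (fun t => (ExceptionalJacobi.P α β F₁ F₂ n).eval t) x =
          -ExceptionalJacobi.lam α β ((n : ℝ) - (ExceptionalJacobi.u F₁ F₂ : ℝ)) *
            (ExceptionalJacobi.P α β F₁ F₂ n).eval x := by
  open ExceptionalJacobi in
  have hne : ∀ f ∈ F₂, ∀ n : ℕ, β ≠ f - n := by
    intro f hf n h
    have hle := F₂.le_max' f hf
    -- If `β = f - n`, then `β - max F₂ - 1` is minus this integer, which is positive because `f ≤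
    -- max F₂`.
    refine (hpar ⟨f, hf⟩ (F₂.max' ⟨f, hf⟩ + 1 + n - f) (by omega)).2 ?_
    rw [h, Nat.cast_sub (by omega)]
    push_cast
    ring
  have hdiff : F₂.card ≠ 0 → ∀ k : ℕ, 1 ≤ k → α - β ≠ -(k : ℝ) := fun h k hk =>
    (hpar (Finset.card_ne_zero.1 h) k hk).1
  have htype : ∀ i, rowType F₁ F₂ i = true → F₂.card ≠ 0 := fun i hi h0 => by
    have h := Finset.card_eq_zero.1 ((card_rowType F₁ F₂).trans h0)
    exact absurd (Finset.mem_filter.2 ⟨Finset.mem_univ i, by simp [hi]⟩) (h ▸ Finset.notMem_empty i)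
  have hdenom : denom F₂ ≠ 0 := pow_ne_zero _ one_add_X_ne_zero
  have hΩdvd : denom F₂ ∣ OmegaNum α β F₁ F₂ := by
    rw [OmegaNum_eq]
    exact pow_dvd_typedDet β _ _ _ (card_rowType F₁ F₂)
  have hΩ : OmegaNum α β F₁ F₂ = denom F₂ * Omega α β F₁ F₂ :=
    (EuclideanDomain.mul_div_cancel' hdenom hΩdvd).symm
  refine ⟨hΩdvd, ?_, fun n hn => ?_⟩
  · have h : OmegaNum α β F₁ F₂ ≠ 0 := by
      rw [OmegaNum_eq]
      exact typedDet_seed_ne_zero _ _ hαβ (fun i hi => hdiff (htype i hi))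
        (twist_sub_rowDegree_injective hne)
    exact right_ne_zero_of_mul (hΩ ▸ h)
  · have hun : u F₁ F₂ ≤ n := hn.1
    have hnF : n - u F₁ F₂ ∉ F₁ := fun h => hn.2 ⟨_, h, by omega⟩
    have hPdvd : denom F₂ ∣ PNum α β F₁ F₂ n := by
      rw [PNum_eq]
      exact pow_dvd_typedDet β _ _ _ (card_cons_rowType F₁ F₂)
    have hP : PNum α β F₁ F₂ n = denom F₂ * P α β F₁ F₂ n :=
      (EuclideanDomain.mul_div_cancel' hdenom hPdvd).symm
    refine ⟨hPdvd, ?_, fun x hx => ?_⟩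
    · have h : PNum α β F₁ F₂ n ≠ 0 := by
        rw [PNum_eq]
        refine typedDet_seed_ne_zero _ _ hαβ (fun i => ?_)
          (cons_twist_sub_rowDegree_injective hne _ hnF)
        refine Fin.cases (by simp) (fun i hi => ?_) i
        exact hdiff (htype i (by simpa using hi))
      exact right_ne_zero_of_mul (hP ▸ h)
    · rw [OmegaNum_eq] at hΩ
      rw [PNum_eq] at hP
      have h := typed_bilinear α β (rowType F₁ F₂) (rowDegree F₁ F₂) (n - u F₁ F₂) F₁.card F₂.card
        rfl (card_rowType F₁ F₂) (card_cons_rowType F₁ F₂) _ _ hΩ hP x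
      rw [Nat.cast_sub hun] at h
      have hd : deriv (fun t => (P α β F₁ F₂ n).eval t) =
          fun t => (derivative (P α β F₁ F₂ n)).eval t := funext fun t => Polynomial.deriv _
      rw [D, hd, Polynomial.deriv, h₁, h₀]
      -- Clearing the denominators `Ω_F` turns the eigenvalue equation into the bilinear identity
      -- `h`.
      field_simp
      linear_combination h
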